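/- Let $\mathcal C\subset\mathbb R$ be the standard middle-third Cantor set, i.e. the unique nonempty compact set with $\mathcal C=\frac13\mathcal C\cup\left(\frac13\mathcal C+\frac23\right)$. Call two metric spaces $(X,d_X)$ and $(Y,d_Y)$ Lipschitz equivalent if there are a bijection $\sigma:X\to Y$ and a constant $C>0$ such that $$C^{-1}d_X(x,y)\le d_Y(\sigma(x),\sigma(y))\le C\,d_X(x,y)\qquad\text{for all }x,y\in X.$$ Let $\alpha$ be a real number such that either $\alpha>1$, or $0\le\alpha\le1$ and $\alpha$ is rational. Then $\mathcal C\cup(\mathcal C+\alpha)$ is Lipschitz equivalent to $\mathcal C$, where $\mathcal C+\alpha=\{x+\alpha : x\in\mathcal C\}$ and both sets carry the Euclidean metric of $\mathbb R$. -/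

import Mathlib

/-- Two metric spaces are Lipschitz equivalent if there are a bijection `σ : X → Y` and a constant
`C > 0` with `C⁻¹ d(x, y) ≤ d(σ x, σ y) ≤ C d(x, y)` for all `x, y`. -/
def LipschitzEquivalent (X Y : Type*) [MetricSpace X] [MetricSpace Y] : Prop :=
  ∃ σ : X → Y, Function.Bijective σ ∧ ∃ C : ℝ, 0 < C ∧
    ∀ x y : X, C⁻¹ * dist x y ≤ dist (σ x) (σ y) ∧ dist (σ x) (σ y) ≤ C * dist x y

/-- The union `𝒞 ∪ (𝒞 + α)` of the middle-third Cantor set and its translate by `α`. -/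
def cantorUnionTranslate (α : ℝ) : Set ℝ :=
  cantorSet ∪ (fun x : ℝ => x + α) '' cantorSet

/-! Since 𝒞 is two disjoint copies of itself at ratio 1/3, a disjoint union of two compact sets
equivalent to 𝒞 is again equivalent to 𝒞 (`LipschitzEquivalent.union`). For α > 1 nothing more is
needed.

For rational α the set is a finite union of translates of 𝒞 by v / q with v in a finite set V of
integers. Factors 3 of q are absorbed into the scale (`cantorTranslates_three_mul`), so let 3 ∤ q.
After scaling, the intervals of level n are coded by exactly 2^n |V| integers, and two intervals
meet iff their integers differ by at most q. Chains of meeting intervals form clusters, and a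
counting argument bounds their size uniformly in n.

Clusters have varying sizes, so the cluster tree does not branch regularly. But k refinements turn a
cluster of m points into m 2^k points, grouped in clusters of bounded size, many of them singletons.
These can be packed, without splitting any, into m bins of exactly 2^k points (`exists_packing`).
The resulting maps between levels have all fibres of size 2^k, and they cut the set into |V|
disjoint compact pieces, each coded by words over 2^k letters with ratio 3^(-k). Since 𝒞 has the
same kind of coding, each piece is equivalent to 𝒞, and the pieces are glued back together. -/

open Finset

/-! ### Integer model: refinement and clusters -/

/-- One step of ternary refinement: the interval `[v, v + q]` is replaced by its left and right
thirds, rescaled by `3`. -/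
def ternaryRefine (q : ℤ) (V : Finset ℤ) : Finset ℤ :=
  V.image (fun v => 3 * v) ∪ V.image (fun v => 3 * v + 2 * q)

/-- The left inverse of both branches of `ternaryRefine`. -/
def ternaryParent (q w : ℤ) : ℤ := if 3 ∣ w then w / 3 else (w - 2 * q) / 3

/-- `t` is the right end of a cluster of `V`. -/
def IsGap (q : ℤ) (V : Finset ℤ) (t : ℤ) : Prop := t ∈ V ∧ ∀ u ∈ V, t < u → t + q < u

open Classical in
/-- The cluster of `w` in `V`, encoded by the set of gaps to the left of `w`. -/
noncomputable def clusterLabel (q : ℤ) (V : Finset ℤ) (w : ℤ) : Finset ℤ :=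
  V.filter (fun t => IsGap q V t ∧ t < w)

section Refine

variable {q : ℤ}

theorem mem_ternaryRefine {V : Finset ℤ} {w : ℤ} :
    w ∈ ternaryRefine q V ↔ ∃ v ∈ V, w = 3 * v ∨ w = 3 * v + 2 * q := by
  simp only [ternaryRefine, mem_union, mem_image]
  constructor
  · rintro (⟨v, hv, rfl⟩ | ⟨v, hv, rfl⟩)
    · exact ⟨v, hv, Or.inl rfl⟩
    · exact ⟨v, hv, Or.inr rfl⟩
  · rintro ⟨v, hv, rfl | rfl⟩
    · exact Or.inl ⟨v, hv, rfl⟩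
    · exact Or.inr ⟨v, hv, rfl⟩

theorem ternaryParent_left (v : ℤ) : ternaryParent q (3 * v) = v := by
  unfold ternaryParent
  split_ifs <;> omega

theorem ternaryParent_right (hq : ¬ (3 : ℤ) ∣ q) (v : ℤ) :
    ternaryParent q (3 * v + 2 * q) = v := by
  unfold ternaryParent
  split_ifs <;> omega

theorem eq_of_mem_ternaryRefine (hq : ¬ (3 : ℤ) ∣ q) {V : Finset ℤ} {w : ℤ}
    (hw : w ∈ ternaryRefine q V) : ternaryParent q w ∈ V ∧
      (w = 3 * ternaryParent q w ∨ w = 3 * ternaryParent q w + 2 * q) := by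
  obtain ⟨v, hv, rfl | rfl⟩ := mem_ternaryRefine.1 hw
  · rw [ternaryParent_left]; exact ⟨hv, Or.inl rfl⟩
  · rw [ternaryParent_right hq]; exact ⟨hv, Or.inr rfl⟩

/-- Left children are multiples of 3 and right children are not, so no two children coincide. -/
theorem card_ternaryRefine (hq : ¬ (3 : ℤ) ∣ q) (V : Finset ℤ) :
    (ternaryRefine q V).card = 2 * V.card := by
  unfold ternaryRefine
  rw [card_union_of_disjoint, card_image_of_injective, card_image_of_injective, two_mul]
  · intro a b h; simp only at h; omega
  · intro a b h; simp only at h; omega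
  · rw [disjoint_left]
    intro a ha hb
    obtain ⟨v, -, rfl⟩ := mem_image.1 ha
    obtain ⟨u, -, hu⟩ := mem_image.1 hb
    omega

theorem card_iterate_ternaryRefine (hq : ¬ (3 : ℤ) ∣ q) (V : Finset ℤ) (k : ℕ) :
    ((ternaryRefine q)^[k] V).card = 2 ^ k * V.card := by
  induction k with
  | zero => simp
  | succ k ih => rw [Function.iterate_succ_apply', card_ternaryRefine hq, ih]; ring

theorem ternaryRefine_filter (hq : ¬ (3 : ℤ) ∣ q) (V : Finset ℤ) (P : ℤ → Prop)
    [DecidablePred P] : ternaryRefine q (V.filter P) =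
      (ternaryRefine q V).filter (fun w => P (ternaryParent q w)) := by
  ext w
  simp only [mem_filter, mem_ternaryRefine]
  constructor
  · rintro ⟨v, ⟨hv, hP⟩, rfl | rfl⟩
    · exact ⟨⟨v, hv, Or.inl rfl⟩, by rwa [ternaryParent_left]⟩
    · exact ⟨⟨v, hv, Or.inr rfl⟩, by rwa [ternaryParent_right hq]⟩
  · rintro ⟨⟨v, hv, rfl | rfl⟩, hP⟩
    · exact ⟨v, ⟨hv, by rwa [ternaryParent_left] at hP⟩, Or.inl rfl⟩
    · exact ⟨v, ⟨hv, by rwa [ternaryParent_right hq] at hP⟩, Or.inr rfl⟩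

theorem iterate_ternaryRefine_filter (hq : ¬ (3 : ℤ) ∣ q) (V : Finset ℤ) (P : ℤ → Prop)
    [DecidablePred P] (k : ℕ) : (ternaryRefine q)^[k] (V.filter P) =
      ((ternaryRefine q)^[k] V).filter (fun w => P ((ternaryParent q)^[k] w)) := by
  induction k with
  | zero => rfl
  | succ k ih =>
    rw [Function.iterate_succ_apply', ih, ternaryRefine_filter hq]
    simp only [Function.iterate_succ_apply', ← Function.iterate_succ_apply]

theorem iterate_ternaryParent_mem (hq : ¬ (3 : ℤ) ∣ q) {V : Finset ℤ} {k : ℕ} {w : ℤ}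
    (hw : w ∈ (ternaryRefine q)^[k] V) : (ternaryParent q)^[k] w ∈ V := by
  induction k generalizing w with
  | zero => simpa using hw
  | succ k ih =>
    rw [Function.iterate_succ_apply'] at hw
    rw [Function.iterate_succ_apply]
    exact ih (eq_of_mem_ternaryRefine hq hw).1

theorem clusterLabel_eq_iff {V : Finset ℤ} {u w : ℤ} :
    clusterLabel q V u = clusterLabel q V w ↔ ∀ t, IsGap q V t → (t < u ↔ t < w) := by
  unfold clusterLabel
  rw [Finset.ext_iff]
  refine forall_congr' fun t => ?_
  simp only [mem_filter]
  constructor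
  · intro h hg
    have := hg.1
    tauto
  · intro h
    tauto

/-- A gap `t` with `u ≤ t < w` would force `w > t + q ≥ u + q`. -/
theorem clusterLabel_eq_of_le {V : Finset ℤ} {u w : ℤ} (hw : w ∈ V) (h1 : u ≤ w)
    (h2 : w ≤ u + q) : clusterLabel q V u = clusterLabel q V w := by
  rw [clusterLabel_eq_iff]
  intro t ht
  constructor
  · intro h; omega
  · intro h
    by_contra h'
    have := ht.2 w hw h
    omega

theorem clusterLabel_eq_of_abs_le {V : Finset ℤ} {u w : ℤ} (hu : u ∈ V) (hw : w ∈ V)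
    (h : |u - w| ≤ q) : clusterLabel q V u = clusterLabel q V w := by
  rw [abs_le] at h
  rcases le_total u w with h' | h'
  · exact clusterLabel_eq_of_le hw h' (by omega)
  · exact (clusterLabel_eq_of_le hu h' (by omega)).symm

/-- Children of points up to `t` are at most `3 * t + 2 * q`; children of points beyond `t + q`
exceed `3 * t + 3 * q`. -/
theorem IsGap.refine (hq : ¬ (3 : ℤ) ∣ q) {V : Finset ℤ} {t : ℤ} (ht : IsGap q V t) :
    IsGap q (ternaryRefine q V) (3 * t + 2 * q) := by
  refine ⟨mem_ternaryRefine.2 ⟨t, ht.1, Or.inr rfl⟩, fun u hu h => ?_⟩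
  obtain ⟨hm, he⟩ := eq_of_mem_ternaryRefine hq hu
  rcases le_or_gt (ternaryParent q u) t with h' | h'
  · omega
  · have := ht.2 _ hm h'
    omega

/-- Gaps survive refinement, so clusters can only be cut further, never merged. -/
theorem clusterLabel_parent (hq0 : 0 < q) (hq : ¬ (3 : ℤ) ∣ q) {V : Finset ℤ} {u w : ℤ}
    (hu : u ∈ ternaryRefine q V) (hw : w ∈ ternaryRefine q V)
    (h : clusterLabel q (ternaryRefine q V) u = clusterLabel q (ternaryRefine q V) w) :
    clusterLabel q V (ternaryParent q u) = clusterLabel q V (ternaryParent q w) := by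
  rw [clusterLabel_eq_iff] at h ⊢
  intro t ht
  have h1 := h _ (ht.refine hq)
  obtain ⟨hm, he⟩ := eq_of_mem_ternaryRefine hq hu
  obtain ⟨hm', he'⟩ := eq_of_mem_ternaryRefine hq hw
  have h2 := ht.2 _ hm
  have h3 := ht.2 _ hm'
  constructor
  · intro h4
    have := h2 h4
    by_contra h5
    omega
  · intro h4
    have := h3 h4
    by_contra h5
    omega

theorem clusterLabel_iterate_parent (hq0 : 0 < q) (hq : ¬ (3 : ℤ) ∣ q) {V : Finset ℤ} (k : ℕ)
    {u w : ℤ} (hu : u ∈ (ternaryRefine q)^[k] V) (hw : w ∈ (ternaryRefine q)^[k] V)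
    (h : clusterLabel q ((ternaryRefine q)^[k] V) u =
      clusterLabel q ((ternaryRefine q)^[k] V) w) :
    clusterLabel q V ((ternaryParent q)^[k] u) = clusterLabel q V ((ternaryParent q)^[k] w) := by
  induction k generalizing u w with
  | zero => simpa using h
  | succ k ih =>
    rw [Function.iterate_succ_apply'] at hu hw h
    rw [Function.iterate_succ_apply, Function.iterate_succ_apply]
    exact ih (eq_of_mem_ternaryRefine hq hu).1 (eq_of_mem_ternaryRefine hq hw).1
      (clusterLabel_parent hq0 hq hu hw h)

/-! ### Isolated points -/

/-- `w` is alone in its cluster. -/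
def IsIsolated (q : ℤ) (V : Finset ℤ) (w : ℤ) : Prop :=
  w ∈ V ∧ ∀ u ∈ V, clusterLabel q V u = clusterLabel q V w → u = w

theorem isGap_of_forall {V : Finset ℤ} {w : ℤ} (hw : w ∈ V)
    (h : ∀ u ∈ V, clusterLabel q V u = clusterLabel q V w → w < u → w + q < u) :
    IsGap q V w := by
  refine ⟨hw, fun u hu hlt => ?_⟩
  by_contra h'
  exact h' (h u hu (clusterLabel_eq_of_le hu hlt.le (by omega)).symm hlt)

/-- The point `w` is then itself a gap, which excludes cluster members to its right. -/
theorem isIsolated_of_forall {V : Finset ℤ} {w : ℤ} (hw : w ∈ V)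
    (h : ∀ u ∈ V, clusterLabel q V u = clusterLabel q V w → u = w ∨ w + q < u)
    (hq0 : 0 < q) : IsIsolated q V w := by
  refine ⟨hw, fun u hu hl => ?_⟩
  have hg : IsGap q V w := isGap_of_forall hw fun u hu hl hlt => by
    rcases h u hu hl with h | h <;> omega
  rcases h u hu hl with h | h
  · exact h
  · have := (clusterLabel_eq_iff.1 hl w hg).1 (by omega)
    omega

/-- Only the sibling could share the cluster, and it lies at distance `2 * q > q`. -/
theorem IsIsolated.left (hq0 : 0 < q) (hq : ¬ (3 : ℤ) ∣ q) {V : Finset ℤ} {w : ℤ}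
    (h : IsIsolated q V w) : IsIsolated q (ternaryRefine q V) (3 * w) := by
  have hm : 3 * w ∈ ternaryRefine q V := mem_ternaryRefine.2 ⟨w, h.1, Or.inl rfl⟩
  refine isIsolated_of_forall hm (fun u hu hl => ?_) hq0
  obtain ⟨hm', he⟩ := eq_of_mem_ternaryRefine hq hu
  have h1 := h.2 _ hm' (by simpa [ternaryParent_left] using clusterLabel_parent hq0 hq hu hm hl)
  omega

theorem IsIsolated.right (hq0 : 0 < q) (hq : ¬ (3 : ℤ) ∣ q) {V : Finset ℤ} {w : ℤ}
    (h : IsIsolated q V w) : IsIsolated q (ternaryRefine q V) (3 * w + 2 * q) := by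
  have hm : 3 * w + 2 * q ∈ ternaryRefine q V := mem_ternaryRefine.2 ⟨w, h.1, Or.inr rfl⟩
  refine ⟨hm, fun u hu hl => ?_⟩
  obtain ⟨hm', he⟩ := eq_of_mem_ternaryRefine hq hu
  have h1 := h.2 _ hm'
    (by simpa [ternaryParent_right hq] using clusterLabel_parent hq0 hq hu hm hl)
  rw [h1] at he
  rcases he with rfl | rfl
  · have := (h.left hq0 hq).2 _ hm hl.symm
    omega
  · rfl

theorem IsIsolated.iterate (hq0 : 0 < q) (hq : ¬ (3 : ℤ) ∣ q) {V : Finset ℤ} {w : ℤ}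
    (h : IsIsolated q V w) (k : ℕ) :
    ∀ u ∈ (ternaryRefine q)^[k] {w}, IsIsolated q ((ternaryRefine q)^[k] V) u := by
  induction k with
  | zero => simpa using h
  | succ k ih =>
    intro u hu
    rw [Function.iterate_succ_apply'] at hu ⊢
    obtain ⟨v, hv, rfl | rfl⟩ := mem_ternaryRefine.1 hu
    · exact (ih v hv).left hq0 hq
    · exact (ih v hv).right hq0 hq

theorem ternaryRefine_mono {U V : Finset ℤ} (h : U ⊆ V) :
    ternaryRefine q U ⊆ ternaryRefine q V := fun w hw => by
  obtain ⟨v, hv, h'⟩ := mem_ternaryRefine.1 hw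
  exact mem_ternaryRefine.2 ⟨v, h hv, h'⟩

theorem iterate_ternaryRefine_mono {U V : Finset ℤ} (h : U ⊆ V) (k : ℕ) :
    (ternaryRefine q)^[k] U ⊆ (ternaryRefine q)^[k] V := by
  induction k with
  | zero => simpa using h
  | succ k ih => rw [Function.iterate_succ_apply', Function.iterate_succ_apply']
                 exact ternaryRefine_mono ih

theorem pow_mul_mem_iterate {V : Finset ℤ} {v : ℤ} (hv : v ∈ V) (j : ℕ) :
    3 ^ j * v ∈ (ternaryRefine q)^[j] V := by
  induction j with
  | zero => simpa using hv
  | succ j ih =>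
    rw [Function.iterate_succ_apply']
    exact mem_ternaryRefine.2 ⟨_, ih, Or.inl (by ring)⟩

/-- The left end of a cluster becomes isolated once `q < 3 ^ j`. -/
theorem isIsolated_pow_mul (hq0 : 0 < q) (hq : ¬ (3 : ℤ) ∣ q) {V : Finset ℤ} {v : ℤ}
    (hv : v ∈ V) (hmin : ∀ u ∈ V, clusterLabel q V u = clusterLabel q V v → v ≤ u)
    {j : ℕ} (hj : q < 3 ^ j) : IsIsolated q ((ternaryRefine q)^[j] V) (3 ^ j * v) := by
  -- Distances to descendants of other points triple at each step, while a new sibling appears at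
  -- distance `2 * q`; hence the minimum.
  have key : ∀ i : ℕ, ∀ u ∈ (ternaryRefine q)^[i] V,
      clusterLabel q ((ternaryRefine q)^[i] V) u =
        clusterLabel q ((ternaryRefine q)^[i] V) (3 ^ i * v) →
      u = 3 ^ i * v ∨ 3 ^ i * v + min (3 ^ i) (2 * q) ≤ u := by
    intro i
    induction i with
    | zero =>
      intro u hu hl
      have := hmin u hu (by simpa using hl)
      simp only [pow_zero, one_mul]
      omega
    | succ i ih =>
      intro u hu hl
      have hm := pow_mul_mem_iterate (q := q) hv (i + 1)
      rw [Function.iterate_succ_apply'] at hu hl hm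
      obtain ⟨hm', he⟩ := eq_of_mem_ternaryRefine hq hu
      have e : (3 : ℤ) ^ (i + 1) * v = 3 * (3 ^ i * v) := by ring
      have h1 := clusterLabel_parent hq0 hq hu hm hl
      rw [e, ternaryParent_left] at h1
      have h2 := ih _ hm' h1
      rw [e]
      have e2 : (3 : ℤ) ^ (i + 1) = 3 * 3 ^ i := by ring
      rw [e2]
      have : (0 : ℤ) < 3 ^ i := by positivity
      generalize (3 : ℤ) ^ i * v = a at *
      generalize (3 : ℤ) ^ i = b at *
      omega
  refine isIsolated_of_forall (pow_mul_mem_iterate hv j) (fun u hu hl => ?_) hq0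
  rcases key j u hu hl with h | h
  · exact Or.inl h
  · right
    have : q + 1 ≤ min (3 ^ j) (2 * q) := le_min (by omega) (by omega)
    omega

/-- Every cluster contains many isolated points after refining often enough. -/
theorem exists_many_isolated (hq0 : 0 < q) (hq : ¬ (3 : ℤ) ∣ q) (V : Finset ℤ) {v : ℤ}
    (hv : v ∈ V) {j k : ℕ} (hj : q < 3 ^ j) (hjk : j ≤ k) :
    ∃ U ⊆ ((ternaryRefine q)^[k] V).filter
        (fun w => clusterLabel q V ((ternaryParent q)^[k] w) = clusterLabel q V v),
      U.card = 2 ^ (k - j) ∧ ∀ u ∈ U, IsIsolated q ((ternaryRefine q)^[k] V) u := by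
  classical
  set A := V.filter (fun w => clusterLabel q V w = clusterLabel q V v) with hA
  have hne : A.Nonempty := ⟨v, by simp [hA, hv]⟩
  -- The leftmost point of the cluster becomes isolated after `j` steps, and all its later
  -- descendants remain so.
  have hmA := mem_filter.1 (A.min'_mem hne)
  have hiso := isIsolated_pow_mul hq0 hq hmA.1
    (fun u hu hl => A.min'_le u (mem_filter.2 ⟨hu, hl.trans hmA.2⟩)) hj
  obtain ⟨i, rfl⟩ := Nat.exists_eq_add_of_le' hjk
  refine ⟨(ternaryRefine q)^[i] {3 ^ j * A.min' hne}, ?_, ?_, ?_⟩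
  · rw [← iterate_ternaryRefine_filter hq V
      (fun w => clusterLabel q V w = clusterLabel q V v) (i + j), Function.iterate_add_apply]
    apply iterate_ternaryRefine_mono
    rw [singleton_subset_iff]
    exact pow_mul_mem_iterate (A.min'_mem hne) j
  · rw [card_iterate_ternaryRefine hq]; simp
  · intro u hu
    rw [Function.iterate_add_apply]
    exact hiso.iterate hq0 hq i u hu

/-! ### Uniform bounds on clusters -/

/-- Windows of length `3 ^ l` contain few points of the refinements. -/
theorem card_window_le {V : Finset ℤ} (hV : V.Nonempty) (l n : ℕ) (a : ℤ) :
    (((ternaryRefine q)^[n] V).filter (fun w => a ≤ w ∧ w < a + 3 ^ l)).card ≤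
      V.card * 2 ^ l := by
  induction l generalizing n a with
  | zero =>
    have : ((ternaryRefine q)^[n] V).filter (fun w => a ≤ w ∧ w < a + 3 ^ 0) ⊆ {a} := by
      intro w hw
      have := (mem_filter.1 hw).2
      simp only [pow_zero] at this
      rw [mem_singleton]; omega
    calc _ ≤ _ := card_le_card this
      _ = 1 := by simp
      _ ≤ _ := by simpa using hV
  | succ l ih =>
    cases n with
    | zero => exact (card_filter_le _ _).trans (Nat.le_mul_of_pos_right _ (by positivity))
    | succ n =>
      -- `-(-a / 3)` is the ceiling of `a / 3`: parents of left children, and of right children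
      -- after a shift, lie in windows a third as long.
      have hsub : ((ternaryRefine q)^[n + 1] V).filter (fun w => a ≤ w ∧ w < a + 3 ^ (l + 1)) ⊆
          (((ternaryRefine q)^[n] V).filter
            (fun w => -(-a / 3) ≤ w ∧ w < -(-a / 3) + 3 ^ l)).image (fun v => 3 * v) ∪
          (((ternaryRefine q)^[n] V).filter
            (fun w => -(-(a - 2 * q) / 3) ≤ w ∧ w < -(-(a - 2 * q) / 3) + 3 ^ l)).image
              (fun v => 3 * v + 2 * q) := by
        intro w hw
        obtain ⟨h1, h2, h3⟩ := mem_filter.1 hw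
        rw [Function.iterate_succ_apply'] at h1
        rw [pow_succ] at h3
        obtain ⟨v, hv, rfl | rfl⟩ := mem_ternaryRefine.1 h1
        · refine mem_union_left _ (mem_image.2 ⟨v, mem_filter.2 ⟨hv, ?_, ?_⟩, rfl⟩) <;> omega
        · refine mem_union_right _ (mem_image.2 ⟨v, mem_filter.2 ⟨hv, ?_, ?_⟩, rfl⟩) <;> omega
      calc _ ≤ _ := card_le_card hsub
        _ ≤ _ := card_union_le _ _
        _ ≤ V.card * 2 ^ l + V.card * 2 ^ l :=
          add_le_add (card_image_le.trans (ih _ _)) (card_image_le.trans (ih _ _))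
        _ = _ := by ring

/-- Clusters have bounded diameter. -/
theorem clusterLabel_lt_add (hq0 : 0 < q) {V : Finset ℤ} (hV : V.Nonempty)
    {l : ℕ} (hl : q * (V.card * 2 ^ l) < 3 ^ l) (n : ℕ) {u w : ℤ}
    (hu : u ∈ (ternaryRefine q)^[n] V)
    (h : clusterLabel q ((ternaryRefine q)^[n] V) u =
      clusterLabel q ((ternaryRefine q)^[n] V) w) : w < u + 3 ^ l := by
  by_contra hlt
  set W := (ternaryRefine q)^[n] V
  -- Without a gap between `u` and `w`, intervals of length `q` started at the points of the window
  -- cover it; there are too few of them for that.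
  have hsub : Finset.Ico u (u + 3 ^ l) ⊆
      (W.filter (fun w => u ≤ w ∧ w < u + 3 ^ l)).biUnion (fun t => Finset.Ico t (t + q)) := by
    intro z hz
    rw [mem_Ico] at hz
    have hne : (W.filter (fun t => u ≤ t ∧ t ≤ z)).Nonempty :=
      ⟨u, mem_filter.2 ⟨hu, le_rfl, hz.1⟩⟩
    set t := (W.filter (fun t => u ≤ t ∧ t ≤ z)).max' hne
    obtain ⟨ht, ht1, ht2⟩ := mem_filter.1 (max'_mem _ hne)
    refine mem_biUnion.2 ⟨t, mem_filter.2 ⟨ht, ht1, by omega⟩, mem_Ico.2 ⟨ht2, ?_⟩⟩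
    by_contra hz'
    have hg : IsGap q W t := by
      refine ⟨ht, fun s hs hts => ?_⟩
      by_contra hs'
      have := le_max' (W.filter (fun t => u ≤ t ∧ t ≤ z)) s
        (mem_filter.2 ⟨hs, by omega, by omega⟩)
      omega
    have := clusterLabel_eq_iff.1 h t hg
    omega
  have hc := card_le_card hsub
  rw [Int.card_Ico] at hc
  have hc2 := hc.trans (card_biUnion_le_card_mul _ _ q.toNat (fun t _ => by simp))
  have hc3 := hc2.trans (Nat.mul_le_mul_right _ (card_window_le hV l n u))
  zify at hc3
  rw [Int.toNat_of_nonneg (by simp), Int.toNat_of_nonneg hq0.le] at hc3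
  simp only [add_sub_cancel_left] at hc3
  rw [mul_comm] at hl
  exact absurd hc3 (not_le.2 hl)

theorem card_cluster_le (hq0 : 0 < q) {V : Finset ℤ} (hV : V.Nonempty)
    {l : ℕ} (hl : q * (V.card * 2 ^ l) < 3 ^ l) (n : ℕ) (i : Finset ℤ) :
    (((ternaryRefine q)^[n] V).filter
      (fun w => clusterLabel q ((ternaryRefine q)^[n] V) w = i)).card ≤ V.card * 2 ^ l := by
  classical
  set A := ((ternaryRefine q)^[n] V).filter
      (fun w => clusterLabel q ((ternaryRefine q)^[n] V) w = i) with hA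
  rcases A.eq_empty_or_nonempty with h | hne
  · simp [h]
  · refine (card_le_card fun w hw => ?_).trans (card_window_le (q := q) hV l n (A.min' hne))
    have h1 := mem_filter.1 hw
    have h2 := mem_filter.1 (A.min'_mem hne)
    exact mem_filter.2 ⟨h1.1, A.min'_le w hw,
      clusterLabel_lt_add hq0 hV hl n h2.1 (h2.2.trans h1.2.symm)⟩

end Refine

/-! ### Packing and even distribution -/

/-- Packing items into bins of capacity `N`, the items of size more than one being few enough. -/
theorem exists_packing {ι α : Type*} [DecidableEq ι] [DecidableEq α] (A : Finset α) (s : ι → ℕ)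
    (N B : ℕ) (F U : Finset ι) (hFU : Disjoint F U) (hs : ∀ i ∈ F, s i ≤ B)
    (hU : ∀ i ∈ U, s i = 1) (hsum : ∑ i ∈ F ∪ U, s i = N * A.card)
    (hBU : A.card * B ≤ U.card) (hA : A.Nonempty) :
    ∃ g : ι → α, (∀ i, g i ∈ A) ∧ ∀ a ∈ A, ∑ i ∈ (F ∪ U).filter (fun i => g i = a), s i = N := by
  obtain ⟨a₀, ha₀⟩ := hA
  -- Averaging: if no bin had room for `i`, summing over the bins would give `A.card * (N + 1) ≤ ∑ i
  -- ∈ G, s i + A.card * s i`.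
  have step : ∀ (G : Finset ι) (g : ι → α), (∀ i, g i ∈ A) →
      (∀ a ∈ A, ∑ i ∈ G.filter (fun i => g i = a), s i ≤ N) → ∀ i ∉ G,
      ∑ i ∈ G, s i + A.card * s i < A.card * (N + 1) →
      ∃ g : ι → α, (∀ i, g i ∈ A) ∧
        ∀ a ∈ A, ∑ i ∈ (insert i G).filter (fun i => g i = a), s i ≤ N := by
    intro G g hgA hg i hi hlt
    have : ∃ a ∈ A, ∑ i ∈ G.filter (fun i => g i = a), s i + s i < N + 1 := by
      by_contra! hcon
      have h1 := Finset.sum_le_sum hcon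
      rw [sum_const, Finset.sum_add_distrib, Finset.sum_fiberwise_of_maps_to (fun i _ => hgA i),
        sum_const, smul_eq_mul, smul_eq_mul] at h1
      omega
    obtain ⟨a, haA, ha⟩ := this
    refine ⟨Function.update g i a, fun j => ?_, fun b hb => ?_⟩
    · by_cases h : j = i
      · subst h; simpa using haA
      · simpa [Function.update_of_ne h] using hgA j
    · have hG : G.filter (fun j => Function.update g i a j = b) = G.filter (fun j => g j = b) := by
        refine filter_congr fun j hj => ?_
        rw [Function.update_of_ne (ne_of_mem_of_not_mem hj hi)]
      rw [filter_insert, hG]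
      simp only [Function.update_self]
      split_ifs with hab
      · subst hab
        rw [sum_insert (fun h => hi (mem_filter.1 h).1)]
        omega
      · exact hg b hb
  have hUsum : ∀ U' ⊆ U, ∑ i ∈ U', s i = U'.card := fun U' h => by
    rw [sum_congr rfl (fun i hi => hU i (h hi))]; simp
  -- The large items go first: the units still outside reserve total room of at least `A.card * B`.
  have hF : ∀ F' ⊆ F, ∃ g : ι → α, (∀ i, g i ∈ A) ∧
      ∀ a ∈ A, ∑ i ∈ F'.filter (fun i => g i = a), s i ≤ N := by
    intro F'
    induction F' using Finset.induction_on with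
    | empty => intro _; exact ⟨fun _ => a₀, fun _ => ha₀, by simp⟩
    | insert i G hi ih =>
      intro hsub
      obtain ⟨g, hgA, hg⟩ := ih ((subset_insert i G).trans hsub)
      refine step G g hgA hg i hi ?_
      have hle : ∑ i ∈ insert i G, s i ≤ ∑ i ∈ F, s i := sum_le_sum_of_subset hsub
      rw [sum_insert hi] at hle
      rw [sum_union hFU, hUsum U subset_rfl] at hsum
      have hsi := hs i (hsub (mem_insert_self _ _))
      have h1 : A.card * s i ≤ A.card * B := Nat.mul_le_mul_left _ hsi
      have h2 : 0 < A.card := card_pos.2 ⟨a₀, ha₀⟩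
      have h3 : A.card * (N + 1) = N * A.card + A.card := by ring
      omega
  have hall : ∀ U' ⊆ U, ∃ g : ι → α, (∀ i, g i ∈ A) ∧
      ∀ a ∈ A, ∑ i ∈ (F ∪ U').filter (fun i => g i = a), s i ≤ N := by
    intro U'
    induction U' using Finset.induction_on with
    | empty => intro _; simpa using hF F subset_rfl
    | insert i G hi ih =>
      intro hsub
      obtain ⟨g, hgA, hg⟩ := ih ((subset_insert i G).trans hsub)
      have hiU : i ∈ U := hsub (mem_insert_self _ _)
      have hi' : i ∉ F ∪ G := by
        rw [mem_union, not_or]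
        exact ⟨fun h => disjoint_left.1 hFU h hiU, hi⟩
      rw [union_insert]
      refine step (F ∪ G) g hgA hg i hi' ?_
      have hle : ∑ i ∈ insert i (F ∪ G), s i ≤ ∑ i ∈ F ∪ U, s i := by
        refine sum_le_sum_of_subset ?_
        rw [← union_insert]
        exact union_subset_union_right hsub
      rw [sum_insert hi', hsum, hU i hiU] at hle
      rw [hU i hiU]
      have h3 : A.card * (N + 1) = N * A.card + A.card := by ring
      omega
  obtain ⟨g, hgA, hg⟩ := hall U subset_rfl
  refine ⟨g, hgA, ?_⟩
  -- No bin overflows and the total is `N * A.card`, so every bin is full.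
  have htot : ∑ a ∈ A, ∑ i ∈ (F ∪ U).filter (fun i => g i = a), s i = ∑ a ∈ A, N := by
    rw [Finset.sum_fiberwise_of_maps_to (fun i _ => hgA i), hsum]
    simp [mul_comm]
  exact (Finset.sum_eq_sum_iff_of_le hg).1 htot

/-- For one cluster, the refined points can be distributed evenly among the points of the
cluster in such a way that refined clusters are not split. -/
theorem exists_even_distribution_cluster {q : ℤ} (hq0 : 0 < q) (hq : ¬ (3 : ℤ) ∣ q)
    (V : Finset ℤ) {B j k : ℕ} (hj : q < 3 ^ j) (hjk : j ≤ k) (hB : B * B ≤ 2 ^ (k - j))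
    (hBV : ∀ i, (V.filter (fun w => clusterLabel q V w = i)).card ≤ B)
    (hBW : ∀ i, (((ternaryRefine q)^[k] V).filter
      (fun w => clusterLabel q ((ternaryRefine q)^[k] V) w = i)).card ≤ B)
    {v : ℤ} (hv : v ∈ V) :
    ∃ g : Finset ℤ → ℤ, (∀ i, g i ∈ V ∧ clusterLabel q V (g i) = clusterLabel q V v) ∧
      ∀ a ∈ V, clusterLabel q V a = clusterLabel q V v →
        (((ternaryRefine q)^[k] V).filter (fun w =>
          clusterLabel q V ((ternaryParent q)^[k] w) = clusterLabel q V v ∧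
          g (clusterLabel q ((ternaryRefine q)^[k] V) w) = a)).card = 2 ^ k := by
  classical
  set W := (ternaryRefine q)^[k] V with hW
  set A := V.filter (fun w => clusterLabel q V w = clusterLabel q V v) with hA
  set D := W.filter (fun w => clusterLabel q V ((ternaryParent q)^[k] w) = clusterLabel q V v)
    with hD
  have hDcard : D.card = 2 ^ k * A.card := by
    rw [hD, hW, ← iterate_ternaryRefine_filter hq V
      (fun w => clusterLabel q V w = clusterLabel q V v), card_iterate_ternaryRefine hq]
  obtain ⟨U₀, hU₀D, hU₀, hiso⟩ := exists_many_isolated hq0 hq V hv hj hjk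
  set lab := clusterLabel q W with hlab
  -- `D` is a union of whole refined clusters, so packing them by label loses nothing.
  have hDlab : ∀ u ∈ D, ∀ w ∈ W, lab w = lab u → w ∈ D := by
    intro u hu w hw h
    have hu' := mem_filter.1 hu
    exact mem_filter.2 ⟨hw, (clusterLabel_iterate_parent hq0 hq k hw hu'.1 h).trans hu'.2⟩
  have hfib : ∀ u ∈ D, W.filter (fun w => lab w = lab u) = D.filter (fun w => lab w = lab u) := by
    intro u hu
    ext w
    simp only [mem_filter]
    exact ⟨fun h => ⟨hDlab u hu w h.1 h.2, h.2⟩, fun h => ⟨(mem_filter.1 h.1).1, h.2⟩⟩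
  let s : Finset ℤ → ℕ := fun i => (D.filter (fun w => lab w = i)).card
  set U := U₀.image lab with hU
  set F := D.image lab \ U with hF
  have hUD : U ⊆ D.image lab := image_subset_image hU₀D
  have hFU : F ∪ U = D.image lab := sdiff_union_of_subset hUD
  have hUcard : U.card = 2 ^ (k - j) := by
    rw [hU, card_image_of_injOn, hU₀]
    intro x hx y hy hxy
    exact (hiso y hy).2 x (hiso x hx).1 hxy
  have hAB : A.card ≤ B := hBV _
  obtain ⟨g, hgA, hg⟩ := exists_packing A s (2 ^ k) B F U sdiff_disjoint
    (fun i _ => (card_le_card (filter_subset_filter _ (filter_subset _ _))).trans (hBW i))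
    (fun i hi => by
      obtain ⟨u, hu, rfl⟩ := mem_image.1 hi
      have : D.filter (fun w => lab w = lab u) = {u} := by
        ext w
        simp only [mem_filter, mem_singleton]
        constructor
        · rintro ⟨h1, h2⟩
          exact (hiso u hu).2 w (mem_filter.1 h1).1 h2
        · rintro rfl
          exact ⟨hU₀D hu, rfl⟩
      simp only [s, this, card_singleton])
    (by rw [hFU, ← hDcard]
        exact (card_eq_sum_card_image lab D).symm)
    (by rw [hUcard]; exact (Nat.mul_le_mul_right _ hAB).trans hB)
    ⟨v, mem_filter.2 ⟨hv, rfl⟩⟩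
  refine ⟨g, fun i => mem_filter.1 (hgA i), fun a ha hal => ?_⟩
  have h := hg a (mem_filter.2 ⟨ha, hal⟩)
  rw [hFU] at h
  rw [← h, ← filter_filter, card_eq_sum_card_fiberwise (f := lab)
    (t := (D.image lab).filter (fun i => g i = a))]
  · refine sum_congr rfl fun i hi => ?_
    have hi := (mem_filter.1 hi).2
    simp only [s]
    congr 1
    ext w
    simp only [mem_filter]
    constructor
    · rintro ⟨⟨h1, h2⟩, h3⟩
      exact ⟨mem_filter.2 h1, h3⟩
    · rintro ⟨h1, rfl⟩
      exact ⟨⟨mem_filter.1 h1, hi⟩, rfl⟩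
  · intro w hw
    have hw := mem_filter.1 hw
    exact mem_coe.2 (mem_filter.2 ⟨mem_image_of_mem _ hw.1, hw.2⟩)

/-- The refined points can be distributed evenly among the points of `V`, inside the same
cluster, in such a way that refined clusters are not split. -/
theorem exists_even_distribution {q : ℤ} (hq0 : 0 < q) (hq : ¬ (3 : ℤ) ∣ q)
    (V : Finset ℤ) {B j k : ℕ} (hj : q < 3 ^ j) (hjk : j ≤ k) (hB : B * B ≤ 2 ^ (k - j))
    (hBV : ∀ i, (V.filter (fun w => clusterLabel q V w = i)).card ≤ B)
    (hBW : ∀ i, (((ternaryRefine q)^[k] V).filter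
      (fun w => clusterLabel q ((ternaryRefine q)^[k] V) w = i)).card ≤ B) :
    ∃ β : ℤ → ℤ, (∀ w ∈ (ternaryRefine q)^[k] V, β w ∈ V ∧
        clusterLabel q V (β w) = clusterLabel q V ((ternaryParent q)^[k] w)) ∧
      (∀ u ∈ (ternaryRefine q)^[k] V, ∀ w ∈ (ternaryRefine q)^[k] V,
        clusterLabel q ((ternaryRefine q)^[k] V) u = clusterLabel q ((ternaryRefine q)^[k] V) w →
          β u = β w) ∧
      ∀ a ∈ V, (((ternaryRefine q)^[k] V).filter (fun w => β w = a)).card = 2 ^ k := by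
  classical
  set W := (ternaryRefine q)^[k] V with hW
  have hex : ∀ I : Finset ℤ, ∃ g : Finset ℤ → ℤ, ∀ v ∈ V, clusterLabel q V v = I →
      (∀ i, g i ∈ V ∧ clusterLabel q V (g i) = I) ∧
      ∀ a ∈ V, clusterLabel q V a = I → (W.filter (fun w =>
          clusterLabel q V ((ternaryParent q)^[k] w) = I ∧
          g (clusterLabel q W w) = a)).card = 2 ^ k := by
    intro I
    by_cases h : ∃ v ∈ V, clusterLabel q V v = I
    · obtain ⟨v, hv, rfl⟩ := h
      obtain ⟨g, hg⟩ := exists_even_distribution_cluster hq0 hq V hj hjk hB hBV hBW hv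
      exact ⟨g, fun _ _ _ => hg⟩
    · exact ⟨fun _ => 0, fun v hv h' => (h ⟨v, hv, h'⟩).elim⟩
  choose g hg using hex
  have hpar : ∀ w ∈ W, (ternaryParent q)^[k] w ∈ V := fun w hw => iterate_ternaryParent_mem hq hw
  refine ⟨fun w => g (clusterLabel q V ((ternaryParent q)^[k] w)) (clusterLabel q W w),
    fun w hw => (hg _ _ (hpar w hw) rfl).1 _, fun u hu w hw h => ?_, fun a ha => ?_⟩
  · simp only [h, clusterLabel_iterate_parent hq0 hq k hu hw h]
  · rw [← (hg _ a ha rfl).2 a ha rfl]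
    congr 1
    refine filter_congr fun w hw => ?_
    constructor
    · intro h
      have := ((hg _ _ (hpar w hw) rfl).1 (clusterLabel q W w)).2
      simp only at h
      rw [h] at this
      exact ⟨this.symm, by rw [this]; exact h⟩
    · rintro ⟨h1, h2⟩
      simp only
      rw [h1]; exact h2

/-! ### Codings by infinite words -/

/-- `X` is coded by infinite words over `N` letters, with contraction ratio `r` per letter. -/
def HasCoding (X : Type*) [MetricSpace X] (N : ℕ) (r : ℝ) : Prop :=
  ∃ c : X → ℕ → Fin N, Function.Surjective c ∧ ∃ D δ : ℝ, 0 < D ∧ 0 < δ ∧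
    (∀ x y j, (∀ i < j, c x i = c y i) → dist x y ≤ D * r ^ j) ∧
    ∀ x y j, c x j ≠ c y j → δ * r ^ j ≤ dist x y

theorem injective_of_dist_le {X α : Type*} [MetricSpace X] {c : X → ℕ → α} {r D : ℝ}
    (hr0 : 0 < r) (hr1 : r < 1)
    (h : ∀ x y j, (∀ i < j, c x i = c y i) → dist x y ≤ D * r ^ j) : Function.Injective c := by
  intro x y hxy
  have h1 : Filter.Tendsto (fun j : ℕ => D * r ^ j) Filter.atTop (nhds (D * 0)) :=
    (tendsto_pow_atTop_nhds_zero_of_lt_one hr0.le hr1).const_mul D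
  rw [mul_zero] at h1
  exact dist_le_zero.1 (ge_of_tendsto' h1 fun j => h x y j fun i _ => by rw [hxy])

/-- Points with the same word are matched; if two words first differ at place `j`, both distances
are comparable to `r ^ j`. -/
theorem HasCoding.lipschitzEquivalent {X Y : Type*} [MetricSpace X] [MetricSpace Y] {N : ℕ}
    {r : ℝ} (hr0 : 0 < r) (hr1 : r < 1) (hX : HasCoding X N r) (hY : HasCoding Y N r) :
    LipschitzEquivalent X Y := by
  obtain ⟨c, hc, D, δ, hD, hδ, hup, hlow⟩ := hX
  obtain ⟨c', hc', D', δ', hD', hδ', hup', hlow'⟩ := hY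
  have inj1 := injective_of_dist_le hr0 hr1 hup
  have inj2 := injective_of_dist_le hr0 hr1 hup'
  let e := Equiv.ofBijective c ⟨inj1, hc⟩
  let e' := Equiv.ofBijective c' ⟨inj2, hc'⟩
  have hσ : ∀ x, c' ((e.trans e'.symm) x) = c x := fun x => e'.apply_symm_apply (e x)
  refine ⟨e.trans e'.symm, (e.trans e'.symm).bijective, max (D / δ') (D' / δ),
    lt_max_of_lt_left (div_pos hD hδ'), fun x y => ?_⟩
  have hC : 0 < max (D / δ') (D' / δ) := lt_max_of_lt_left (div_pos hD hδ')
  by_cases hxy : x = y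
  · subst hxy; simp
  have hne : ∃ j, c x j ≠ c y j := by
    by_contra! h
    exact hxy (inj1 (funext h))
  classical
  set j := Nat.find hne
  have hj : c x j ≠ c y j := Nat.find_spec hne
  have hj' : ∀ i < j, c x i = c y i := fun i hi => not_not.1 (Nat.find_min hne hi)
  have h1 := hup x y j hj'
  have h2 := hlow x y j hj
  have h3 := hup' ((e.trans e'.symm) x) ((e.trans e'.symm) y) j
    (fun i hi => by rw [hσ, hσ]; exact hj' i hi)
  have h4 := hlow' ((e.trans e'.symm) x) ((e.trans e'.symm) y) j
    (by rw [hσ, hσ]; exact hj)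
  have hrj : 0 < r ^ j := by positivity
  constructor
  · rw [inv_mul_le_iff₀ hC]
    calc dist x y ≤ D * r ^ j := h1
      _ = D / δ' * (δ' * r ^ j) := by field_simp
      _ ≤ _ := mul_le_mul (le_max_left _ _) h4 (by positivity) hC.le
  · calc _ ≤ D' * r ^ j := h3
      _ = D' / δ * (δ * r ^ j) := by field_simp
      _ ≤ _ := mul_le_mul (le_max_right _ _) h2 (by positivity) hC.le

/-- A set described by a tower of finite sets in which every point has exactly `N` successors
is a disjoint union of coded sets. -/
theorem hasCoding_of_tower {X : Set ℝ} (hX : IsClosed X) {W : ℕ → Finset ℤ} {β : ℕ → ℤ → ℤ}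
    {s : ℕ → ℝ → ℤ} {N : ℕ} {r D δ : ℝ} (hr0 : 0 < r) (hr1 : r < 1) (hD : 0 < D) (hδ : 0 < δ)
    (hs : ∀ j, ∀ x ∈ X, s j x ∈ W j) (hβs : ∀ j, ∀ x ∈ X, β j (s (j + 1) x) = s j x)
    (hfib : ∀ j, ∀ a ∈ W j, ((W (j + 1)).filter (fun w => β j w = a)).card = N)
    (hup : ∀ j, ∀ x ∈ X, ∀ y ∈ X, s j x = s j y → |x - y| ≤ D * r ^ j)
    (hlow : ∀ j, ∀ x ∈ X, ∀ y ∈ X, s j x ≠ s j y → δ * r ^ j ≤ |x - y|)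
    (honto : ∀ j, ∀ a ∈ W j, ∃ x ∈ X, s j x = a) {v : ℤ} (hv : v ∈ W 0) :
    HasCoding {x | x ∈ X ∧ s 0 x = v} N r := by
  classical
  have he : ∀ j a, ∃ d : ℤ → Fin N, a ∈ W j →
      (∀ t : Fin N, ∃ w ∈ W (j + 1), β j w = a ∧ d w = t) ∧
      (∀ u ∈ W (j + 1), ∀ w ∈ W (j + 1), β j u = a → β j w = a → d u = d w → u = w) := by
    intro j a
    by_cases ha : a ∈ W j
    · have e := (Finset.equivFinOfCardEq (hfib j a ha))
      have hN : Nonempty (Fin N) := by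
        obtain ⟨x, hx, hxa⟩ := honto j a ha
        exact ⟨e ⟨s (j + 1) x, mem_filter.2 ⟨hs _ x hx, (hβs j x hx).trans hxa⟩⟩⟩
      obtain ⟨t₀⟩ := hN
      refine ⟨fun w => if h : w ∈ (W (j + 1)).filter (fun w => β j w = a) then e ⟨w, h⟩ else t₀,
        fun _ => ⟨fun t => ?_, fun u hu w hw hua hwa h => ?_⟩⟩
      · obtain ⟨h1, h2⟩ := mem_filter.1 (e.symm t).2
        refine ⟨e.symm t, h1, h2, ?_⟩
        beta_reduce
        rw [dif_pos (e.symm t).2]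
        simp
      · beta_reduce at h
        rw [dif_pos (mem_filter.2 ⟨hu, hua⟩), dif_pos (mem_filter.2 ⟨hw, hwa⟩)] at h
        simpa using h
    -- Outside `W j` any numbering will do, but some letter must exist; the fibre over `v` supplies
    -- one.
    · by_cases hN : Nonempty (Fin N)
      · exact ⟨fun _ => hN.some, fun h => (ha h).elim⟩
      · exfalso
        obtain ⟨x, hx, hxa⟩ := honto 0 v hv
        have : 0 < ((W (0 + 1)).filter (fun w => β 0 w = v)).card :=
          card_pos.2 ⟨s 1 x, mem_filter.2 ⟨hs 1 x hx, (hβs 0 x hx).trans hxa⟩⟩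
        rw [hfib 0 v hv] at this
        exact hN ⟨⟨0, this⟩⟩
  choose d hd using he
  have hanti : ∀ x ∈ X, ∀ y ∈ X, ∀ j, s (j + 1) x = s (j + 1) y → s j x = s j y := by
    intro x hx y hy j h
    rw [← hβs j x hx, ← hβs j y hy, h]
  have hle : ∀ x ∈ X, ∀ y ∈ X, ∀ i j, i ≤ j → s j x = s j y → s i x = s i y := by
    intro x hx y hy i j hij
    induction hij with
    | refl => exact id
    | step _ ih => exact fun h => ih (hanti x hx y hy _ h)
  -- Letter `j` names the successor within its fibre, so a difference there shows only at level `j +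
  -- 1`; hence `δ * r`.
  refine ⟨fun x j => d j (s j x) (s (j + 1) x), ?_, D, δ * r, hD, by positivity, ?_, ?_⟩
  · intro t
    have hS : ∃ S : ℕ → ℤ, S 0 = v ∧ (∀ j, S j ∈ W j) ∧
        ∀ j, β j (S (j + 1)) = S j ∧ d j (S j) (S (j + 1)) = t j := by
      have hnext : ∀ j, ∀ a : W j, ∃ b : W (j + 1), β j b = a ∧ d j a b = t j := by
        rintro j ⟨a, ha⟩
        obtain ⟨b, hb, h1, h2⟩ := (hd j a ha).1 (t j)
        exact ⟨⟨b, hb⟩, h1, h2⟩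
      choose nx hnx using hnext
      let S : (j : ℕ) → W j := fun j => Nat.rec (motive := fun j => W j) ⟨v, hv⟩ (fun j a => nx j a) j
      exact ⟨fun j => S j, rfl, fun j => (S j).2, fun j => hnx j (S j)⟩
    obtain ⟨S, hS0, hSW, hS⟩ := hS
    choose z hz hzS using fun j => honto j (S j) (hSW j)
    have hzle : ∀ i j, i ≤ j → s i (z j) = S i := by
      intro i j hij
      induction hij using Nat.decreasingInduction with
      | self => exact hzS j
      | of_succ i _ ih => rw [← hβs i _ (hz j), ih, (hS i).1]
    have hdist : ∀ j, dist (z j) (z (j + 1)) ≤ D * r ^ j := fun j => by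
      rw [Real.dist_eq]
      exact hup j _ (hz _) _ (hz _) (by rw [hzle j j le_rfl, hzle j (j + 1) (Nat.le_succ j)])
    obtain ⟨x, hx⟩ := cauchySeq_tendsto_of_complete (cauchySeq_of_le_geometric r D hr1 hdist)
    have hxX : x ∈ X := hX.mem_of_tendsto hx (Filter.Eventually.of_forall hz)
    -- By `hlow`, `s j` is locally constant on `X`, so its value passes to the limit.
    have hxS : ∀ j, s j x = S j := by
      intro j
      by_contra hne
      have h1 : Filter.Tendsto (fun i => |x - z i|) Filter.atTop (nhds |x - x|) :=
        (tendsto_const_nhds.sub hx).abs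
      rw [sub_self, abs_zero] at h1
      have h2 : δ * r ^ j ≤ 0 := ge_of_tendsto h1 (Filter.eventually_atTop.2 ⟨j, fun i hi =>
        hlow j x hxX _ (hz i) (by rw [hzle j i hi]; exact hne)⟩)
      have : 0 < δ * r ^ j := by positivity
      linarith
    refine ⟨⟨x, hxX, (hxS 0).trans hS0⟩, funext fun j => ?_⟩
    simp only [hxS]
    exact (hS j).2
  · rintro ⟨x, hx, hx0⟩ ⟨y, hy, hy0⟩ j h
    rw [Subtype.dist_eq, Real.dist_eq]
    refine hup j x hx y hy ?_
    have : ∀ i ≤ j, s i x = s i y := by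
      intro i
      induction i with
      | zero => intro _; rw [hx0, hy0]
      | succ i ih =>
        intro hi
        have h1 := ih (by omega)
        have h2 := h i (by omega)
        simp only [h1] at h2
        exact (hd i (s i y) (hs i y hy)).2 _ (hs _ x hx) _ (hs _ y hy)
          ((hβs i x hx).trans h1) (hβs i y hy) h2
    exact this j le_rfl
  · rintro ⟨x, hx, hx0⟩ ⟨y, hy, hy0⟩ j h
    rw [Subtype.dist_eq, Real.dist_eq]
    have := hlow (j + 1) x hx y hy (fun he => h (by
      simp only [he, hle x hx y hy j (j + 1) (Nat.le_succ j) he]))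
    calc _ = _ := by ring
      _ ≤ _ := this

/-! ### Unions of scaled translates of the Cantor set -/

theorem mem_cantorSet_iff {y : ℝ} : y ∈ cantorSet ↔ 3 * y ∈ cantorSet ∨ 3 * y - 2 ∈ cantorSet := by
  conv_lhs => rw [cantorSet_eq_union_halves]
  simp only [Set.mem_union, Set.mem_image]
  constructor
  · rintro (⟨c, hc, rfl⟩ | ⟨c, hc, rfl⟩)
    · left; convert hc using 1; ring
    · right; convert hc using 1; ring
  · rintro (h | h)
    · exact Or.inl ⟨_, h, by ring⟩
    · exact Or.inr ⟨_, h, by ring⟩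

/-- The union of the sets `μ⁻¹ (v / q + 𝒞)` for `v ∈ V`. -/
def cantorTranslates (q : ℤ) (V : Finset ℤ) (μ : ℝ) : Set ℝ :=
  {x | ∃ v ∈ V, μ * x - v / q ∈ cantorSet}

theorem isClosed_cantorTranslates (q : ℤ) (V : Finset ℤ) (μ : ℝ) :
    IsClosed (cantorTranslates q V μ) := by
  have : cantorTranslates q V μ = ⋃ v ∈ V, (fun x : ℝ => μ * x - v / q) ⁻¹' cantorSet := by
    ext x; simp [cantorTranslates]
  rw [this]
  exact isClosed_biUnion_finset fun v _ => isClosed_cantorSet.preimage (by fun_prop)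

theorem isCompact_cantorTranslates (q : ℤ) (V : Finset ℤ) {μ : ℝ} (hμ : 0 < μ) :
    IsCompact (cantorTranslates q V μ) := by
  have : cantorTranslates q V μ = ⋃ v ∈ V, (fun c : ℝ => μ⁻¹ * (c + v / q)) '' cantorSet := by
    ext x
    simp only [cantorTranslates, Set.mem_ofPred_eq, Set.mem_iUnion, Set.mem_image, exists_prop]
    refine exists_congr fun v => and_congr_right fun _ => ?_
    constructor
    · intro h
      exact ⟨_, h, by field_simp; ring⟩
    · rintro ⟨c, hc, rfl⟩
      convert hc using 1
      field_simp; ring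
  rw [this]
  exact V.isCompact_biUnion fun v _ => isCompact_cantorSet.image (by fun_prop)

theorem cantorTranslates_ternaryRefine {q : ℤ} (hq : q ≠ 0) (V : Finset ℤ) (μ : ℝ) :
    cantorTranslates q (ternaryRefine q V) (3 * μ) = cantorTranslates q V μ := by
  have hq' : (q : ℝ) ≠ 0 := by exact_mod_cast hq
  ext x
  simp only [cantorTranslates, Set.mem_ofPred_eq]
  constructor
  · rintro ⟨w, hw, h⟩
    obtain ⟨v, hv, rfl | rfl⟩ := mem_ternaryRefine.1 hw
    · refine ⟨v, hv, mem_cantorSet_iff.2 (Or.inl ?_)⟩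
      convert h using 1; push_cast; ring
    · refine ⟨v, hv, mem_cantorSet_iff.2 (Or.inr ?_)⟩
      convert h using 1; push_cast; field_simp; ring
  · rintro ⟨v, hv, h⟩
    rcases mem_cantorSet_iff.1 h with h | h
    · refine ⟨3 * v, mem_ternaryRefine.2 ⟨v, hv, Or.inl rfl⟩, ?_⟩
      convert h using 1; push_cast; ring
    · refine ⟨3 * v + 2 * q, mem_ternaryRefine.2 ⟨v, hv, Or.inr rfl⟩, ?_⟩
      convert h using 1; push_cast; field_simp; ring

theorem cantorTranslates_iterate {q : ℤ} (hq : q ≠ 0) (V : Finset ℤ) (μ : ℝ) (n : ℕ) :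
    cantorTranslates q ((ternaryRefine q)^[n] V) (3 ^ n * μ) = cantorTranslates q V μ := by
  induction n with
  | zero => simp
  | succ n ih =>
    rw [Function.iterate_succ_apply', pow_succ', mul_assoc, cantorTranslates_ternaryRefine hq, ih]

/-- The intervals containing a given point are compatible with `ternaryParent`. -/
theorem sub_ternaryParent_mem_cantorSet {q : ℤ} (hq0 : q ≠ 0) (hq : ¬ (3 : ℤ) ∣ q) {V : Finset ℤ}
    (k : ℕ) {y : ℝ} {w : ℤ} (hw : w ∈ (ternaryRefine q)^[k] V)
    (h : 3 ^ k * y - w / q ∈ cantorSet) :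
    y - ((ternaryParent q)^[k] w : ℤ) / q ∈ cantorSet := by
  have hq' : (q : ℝ) ≠ 0 := by exact_mod_cast hq0
  induction k generalizing w with
  | zero => simpa using h
  | succ k ih =>
    rw [Function.iterate_succ_apply'] at hw
    rw [Function.iterate_succ_apply]
    obtain ⟨hm, he⟩ := eq_of_mem_ternaryRefine hq hw
    refine ih hm (mem_cantorSet_iff.2 ?_)
    rcases he with he | he
    · left
      rw [he] at h
      convert h using 1; push_cast; ring
    · right
      rw [he] at h
      convert h using 1; push_cast; field_simp; ring

theorem abs_sub_le_of_mem_cantorSet {q : ℤ} (hq : 0 < q) {y : ℝ} {u w : ℤ}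
    (hu : y - u / q ∈ cantorSet) (hw : y - w / q ∈ cantorSet) : |u - w| ≤ q := by
  have hu := cantorSet_subset_unitInterval hu
  have hw := cantorSet_subset_unitInterval hw
  have hq' : (0 : ℝ) < q := by exact_mod_cast hq
  rw [Set.mem_Icc] at hu hw
  have e : ((u : ℝ) - w) = ((y - w / q) - (y - u / q)) * q := by field_simp; ring
  have : |(u : ℝ) - w| ≤ q := by
    rw [e, abs_mul, abs_of_pos hq']
    refine mul_le_of_le_one_left hq'.le ?_
    rw [abs_le]; constructor <;> linarith
  exact_mod_cast this

theorem exists_mul_two_pow_lt_three_pow (a : ℤ) : ∃ l : ℕ, a * 2 ^ l < 3 ^ l := by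
  obtain ⟨l, hl⟩ := pow_unbounded_of_one_lt (a : ℝ) (by norm_num : (1 : ℝ) < 3 / 2)
  refine ⟨l, ?_⟩
  rw [div_pow, lt_div_iff₀ (by positivity)] at hl
  exact_mod_cast hl

/-- The tower has one floor per `k` refinements. Every large `k` is allowed, so that two sets can be
coded with the same alphabet and ratio. -/
theorem exists_coded_partition {q : ℤ} (hq0 : 0 < q) (hq : ¬ (3 : ℤ) ∣ q) {V : Finset ℤ}
    (hV : V.Nonempty) {μ : ℝ} (hμ : 0 < μ) :
    ∃ k₀ : ℕ, ∀ k ≥ k₀, ∃ K : ℤ → Set ℝ,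
      (∀ v ∈ V, IsCompact (K v) ∧ HasCoding (K v) (2 ^ k) ((3 ^ k)⁻¹)) ∧
      (∀ u v, u ≠ v → Disjoint (K u) (K v)) ∧
      cantorTranslates q V μ = ⋃ v ∈ V, K v := by
  have hq1 : q ≠ 0 := hq0.ne'
  have hqR : (0 : ℝ) < q := by exact_mod_cast hq0
  obtain ⟨l, hl⟩ := exists_mul_two_pow_lt_three_pow (q * V.card)
  rw [mul_assoc] at hl
  obtain ⟨j₀, hj₀⟩ : ∃ j : ℕ, q < 3 ^ j := pow_unbounded_of_one_lt q (by norm_num)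
  set B := V.card * 2 ^ l with hB
  -- `B * B` provides enough singletons for the packing; the `1` makes `k` positive, hence the ratio
  -- less than 1.
  refine ⟨j₀ + B * B + 1, fun k hk => ?_⟩
  have hBk : B * B ≤ 2 ^ (k - j₀) :=
    Nat.lt_two_pow_self.le.trans (Nat.pow_le_pow_right (by norm_num) (by omega))
  set W : ℕ → Finset ℤ := fun j => (ternaryRefine q)^[k * j] V with hW
  have hWs : ∀ j, W (j + 1) = (ternaryRefine q)^[k] (W j) := fun j => by
    simp only [hW]
    rw [mul_add, mul_one, add_comm, Function.iterate_add_apply]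
  have hex := fun j => exists_even_distribution hq0 hq (W j) hj₀ (by omega) hBk
    (fun i => card_cluster_le hq0 hV hl (k * j) i)
    (fun i => by rw [← hWs]; exact card_cluster_le hq0 hV hl (k * (j + 1)) i)
  simp only [← hWs] at hex
  choose β hβV hβl hβf using hex
  set X := cantorTranslates q V μ with hX
  have hXW : ∀ j x, ∃ w, x ∈ X → w ∈ W j ∧ 3 ^ (k * j) * μ * x - w / q ∈ cantorSet := by
    intro j x
    by_cases hx : x ∈ X
    · rw [hX, ← cantorTranslates_iterate hq1 V μ (k * j)] at hx
      obtain ⟨w, hw, h⟩ := hx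
      exact ⟨w, fun _ => ⟨hw, h⟩⟩
    · exact ⟨0, fun h => (hx h).elim⟩
  choose w hw using hXW
  have hlab : ∀ j x u v, u ∈ W j → v ∈ W j → 3 ^ (k * j) * μ * x - u / q ∈ cantorSet →
      3 ^ (k * j) * μ * x - v / q ∈ cantorSet →
      clusterLabel q (W j) u = clusterLabel q (W j) v := fun j x u v hu hv hu' hv' =>
    clusterLabel_eq_of_abs_le hu hv (abs_sub_le_of_mem_cantorSet hq0 hu' hv')
  -- The interval `w (j + 1) x` is a choice, but its cluster is determined by `x`, and `β j` is
  -- constant on clusters.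
  set s : ℕ → ℝ → ℤ := fun j x => β j (w (j + 1) x) with hs
  have hsW : ∀ j, ∀ x ∈ X, s j x ∈ W j := fun j x hx => (hβV j _ (hw (j + 1) x hx).1).1
  have hsl : ∀ j, ∀ x ∈ X, clusterLabel q (W j) (s j x) = clusterLabel q (W j) (w j x) := by
    intro j x hx
    obtain ⟨h1, h2⟩ := hw (j + 1) x hx
    rw [(hβV j _ h1).2]
    have h1' := h1
    rw [hWs] at h1
    refine hlab j x _ _ (iterate_ternaryParent_mem hq h1) (hw j x hx).1
      (sub_ternaryParent_mem_cantorSet hq1 hq k h1 ?_) (hw j x hx).2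
    convert h2 using 2
    ring
  have hup : ∀ j, ∀ x ∈ X, ∀ y ∈ X, s j x = s j y →
      |x - y| ≤ (2 * (1 + 3 ^ l) / μ) * ((3 ^ k)⁻¹) ^ j := by
    have hbd : ∀ j, ∀ x ∈ X, |3 ^ (k * j) * μ * x - s j x / q| ≤ 1 + 3 ^ l := by
      intro j x hx
      obtain ⟨h1, h2⟩ := hw j x hx
      have h3 := clusterLabel_lt_add hq0 hV hl (k * j) h1 (hsl j x hx).symm
      have h4 := clusterLabel_lt_add hq0 hV hl (k * j) (hsW j x hx) (hsl j x hx)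
      have h5 := cantorSet_subset_unitInterval h2
      have h6 : |(w j x : ℝ) - s j x| ≤ 3 ^ l := by
        have : |w j x - s j x| ≤ 3 ^ l := by rw [abs_le]; constructor <;> omega
        exact_mod_cast this
      have h7 : |((w j x : ℝ) - s j x) / q| ≤ 3 ^ l := by
        rw [abs_div, abs_of_pos hqR]
        refine (div_le_self (abs_nonneg _) ?_).trans h6
        exact_mod_cast hq0
      calc |3 ^ (k * j) * μ * x - s j x / q|
          = |(3 ^ (k * j) * μ * x - w j x / q) + ((w j x : ℝ) - s j x) / q| := by
            congr 1; ring
        _ ≤ _ := abs_add_le _ _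
        _ ≤ 1 + 3 ^ l := add_le_add (abs_le.2 ⟨by linarith [h5.1], h5.2⟩) h7
    intro j x hx y hy h
    have h1 := hbd j x hx
    have h2 := hbd j y hy
    rw [h] at h1
    have h3 : |(3 : ℝ) ^ (k * j) * μ * (x - y)| ≤ 2 * (1 + 3 ^ l) := by
      rw [abs_le] at *
      constructor <;> linarith
    rw [abs_mul, abs_of_pos (by positivity)] at h3
    rw [inv_pow, ← pow_mul, div_mul_eq_mul_div, le_div_iff₀ hμ, ← div_eq_mul_inv,
      le_div_iff₀ (by positivity)]
    linarith
  have hlow : ∀ j, ∀ x ∈ X, ∀ y ∈ X, s j x ≠ s j y →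
      (1 / (q * μ * 3 ^ k)) * ((3 ^ k)⁻¹) ^ j ≤ |x - y| := by
    intro j x hx y hy h
    obtain ⟨h1, h2⟩ := hw (j + 1) x hx
    obtain ⟨h3, h4⟩ := hw (j + 1) y hy
    -- Different values of `s j` force different clusters one floor down, so the integers differ by
    -- at least `q + 1`; the surplus 1 gives rescaled distance at least `1 / q`.
    have h5 : ¬ |w (j + 1) x - w (j + 1) y| ≤ q := fun h' =>
      h (hβl j _ h1 _ h3 (clusterLabel_eq_of_abs_le h1 h3 h'))
    have h6 : (q : ℝ) + 1 ≤ |(w (j + 1) x : ℝ) - w (j + 1) y| := by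
      have : q + 1 ≤ |w (j + 1) x - w (j + 1) y| := by omega
      exact_mod_cast this
    have h2 := cantorSet_subset_unitInterval h2
    have h4 := cantorSet_subset_unitInterval h4
    set a := (3 : ℝ) ^ (k * (j + 1)) * μ with ha
    have ha0 : 0 < a := by positivity
    clear_value a
    have h7 : 1 ≤ q * a * |x - y| := by
      have e : (w (j + 1) x : ℝ) - w (j + 1) y =
          q * (a * (x - y)) - q * ((a * x - w (j + 1) x / q) - (a * y - w (j + 1) y / q)) := by
        field_simp; ring
      have h8 : |(a * x - w (j + 1) x / q) - (a * y - w (j + 1) y / q)| ≤ 1 := by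
        rw [abs_le]; constructor <;> linarith [h2.1, h2.2, h4.1, h4.2]
      have h9 := abs_sub (q * (a * (x - y)))
        (q * ((a * x - w (j + 1) x / q) - (a * y - w (j + 1) y / q)))
      rw [← e, abs_mul, abs_mul, abs_mul, abs_of_pos hqR, abs_of_pos ha0] at h9
      have := mul_le_mul_of_nonneg_left h8 hqR.le
      linarith
    have e2 : (1 / (q * μ * 3 ^ k)) * (((3 : ℝ) ^ k)⁻¹) ^ j = 1 / (q * a) := by
      rw [ha, mul_add, pow_add, mul_one, pow_mul, inv_pow]
      field_simp
    rw [e2, div_le_iff₀ (by positivity)]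
    linarith
  have hβs : ∀ j, ∀ x ∈ X, β j (s (j + 1) x) = s j x := fun j x hx =>
    hβl j _ (hsW (j + 1) x hx) _ (hw (j + 1) x hx).1 (hsl (j + 1) x hx)
  have honto : ∀ j, ∀ a ∈ W j, ∃ x ∈ X, s j x = a := by
    intro j a ha
    have hpos : 0 < ((W (j + 1)).filter (fun w => β j w = a)).card := by
      rw [hβf j a ha]; positivity
    obtain ⟨u, hu⟩ := card_pos.1 hpos
    obtain ⟨hu, hua⟩ := mem_filter.1 hu
    have hz : (3 : ℝ) ^ (k * (j + 1)) * μ * ((u / q) / (3 ^ (k * (j + 1)) * μ)) - u / q ∈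
        cantorSet := by
      rw [mul_div_cancel₀ _ (by positivity), sub_self]
      exact zero_mem_cantorSet
    have hzX : (u / q : ℝ) / (3 ^ (k * (j + 1)) * μ) ∈ X := by
      rw [hX, ← cantorTranslates_iterate hq1 V μ (k * (j + 1))]
      exact ⟨u, hu, hz⟩
    refine ⟨_, hzX, ?_⟩
    obtain ⟨h1, h2⟩ := hw (j + 1) _ hzX
    rw [← hua]
    exact hβl j _ h1 _ hu (hlab (j + 1) _ _ _ h1 hu h2 hz)
  have hδ : (0 : ℝ) < 1 / (q * μ * 3 ^ k) := by positivity
  have hXc : IsClosed X := isClosed_cantorTranslates q V μ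
  refine ⟨fun v => {x | x ∈ X ∧ s 0 x = v}, fun v hv => ⟨?_, ?_⟩, ?_, ?_⟩
  -- `hlow 0` keeps distinct pieces a positive distance apart, so each is closed.
  · refine (isCompact_cantorTranslates q V hμ).of_isClosed_subset
      (isClosed_of_closure_subset fun x hx => ?_) (fun x hx => hx.1)
    have hxX : x ∈ X := hXc.closure_subset_iff.2 (fun y hy => hy.1) hx
    obtain ⟨y, hy, hxy⟩ := Metric.mem_closure_iff.1 hx _ hδ
    refine ⟨hxX, ?_⟩
    by_contra hne
    have := hlow 0 x hxX y hy.1 (by rw [hy.2]; exact hne)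
    rw [pow_zero, mul_one, ← Real.dist_eq] at this
    linarith
  · refine hasCoding_of_tower hXc (W := W) (β := β) (by positivity) (inv_lt_one_of_one_lt₀
      (one_lt_pow₀ (by norm_num) (by omega))) (by positivity) hδ hsW hβs hβf hup hlow honto ?_
    simpa [hW] using hv
  · intro u v huv
    exact Set.disjoint_left.2 fun x hx hx' => huv (hx.2.symm.trans hx'.2)
  · ext x
    simp only [Set.mem_iUnion, Set.mem_ofPred_eq, exists_prop]
    constructor
    · intro hx
      exact ⟨s 0 x, by simpa [hW] using hsW 0 x hx, hx, rfl⟩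
    · rintro ⟨v, -, hx, -⟩
      exact hx

/-! ### Gluing disjoint pieces -/

/-- The two sets are sent to the two halves of 𝒞. Distances across are bounded above and away from
zero on both sides. -/
theorem LipschitzEquivalent.union {S T : Set ℝ} (hS : IsCompact S) (hT : IsCompact T)
    (hST : Disjoint S T) (hSC : LipschitzEquivalent S cantorSet)
    (hTC : LipschitzEquivalent T cantorSet) : LipschitzEquivalent ↥(S ∪ T) cantorSet := by
  classical
  obtain ⟨f, hf, C₁, hC₁, hf'⟩ := hSC
  obtain ⟨g, hg, C₂, hC₂, hg'⟩ := hTC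
  obtain ⟨δ, hδ, hδ'⟩ : ∃ δ : ℝ, 0 < δ ∧ ∀ x ∈ S, ∀ y ∈ T, δ ≤ dist x y := by
    obtain ⟨r, hr, h⟩ := hST.exists_thickenings hS hT.isClosed
    refine ⟨r, hr, fun x hx y hy => ?_⟩
    by_contra! hlt
    exact Set.disjoint_left.1 h (Metric.mem_thickening_iff.2 ⟨x, hx, by rwa [dist_comm]⟩)
      (Metric.self_subset_thickening hr T hy)
  obtain ⟨D, hD, hD'⟩ : ∃ D : ℝ, 0 < D ∧ ∀ x ∈ S, ∀ y ∈ T, dist x y ≤ D := by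
    obtain ⟨D, hD⟩ := Metric.isBounded_iff.1 (hS.isBounded.union hT.isBounded)
    exact ⟨max D 1, by positivity, fun x hx y hy => (hD (Or.inl hx) (Or.inr hy)).trans
      (le_max_left _ _)⟩
  have hl : ∀ c : cantorSet, (c : ℝ) / 3 ∈ cantorSet := fun c =>
    mem_cantorSet_iff.2 (Or.inl (by convert c.2 using 1; ring))
  have hr : ∀ c : cantorSet, (c : ℝ) / 3 + 2 / 3 ∈ cantorSet := fun c =>
    mem_cantorSet_iff.2 (Or.inr (by convert c.2 using 1; ring))
  have hI : ∀ c : cantorSet, 0 ≤ (c : ℝ) ∧ (c : ℝ) ≤ 1 := fun c =>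
    cantorSet_subset_unitInterval c.2
  have hTn : ∀ x : ↥(S ∪ T), (x : ℝ) ∉ S → (x : ℝ) ∈ T := fun x h => x.2.resolve_left h
  let σ : ↥(S ∪ T) → cantorSet := fun x =>
    if h : (x : ℝ) ∈ S then ⟨f ⟨x, h⟩ / 3, hl _⟩ else ⟨g ⟨x, hTn x h⟩ / 3 + 2 / 3, hr _⟩
  have hσS : ∀ (x : ↥(S ∪ T)) (h : (x : ℝ) ∈ S), (σ x : ℝ) = f ⟨x, h⟩ / 3 := fun x h => by
    simp only [σ, dif_pos h]
  have hσT : ∀ (x : ↥(S ∪ T)) (h : (x : ℝ) ∉ S),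
      (σ x : ℝ) = g ⟨x, hTn x h⟩ / 3 + 2 / 3 := fun x h => by
    simp only [σ, dif_neg h]
  -- The terms `3 * C₁` and `3 * C₂` serve pairs inside one set; across, image distances lie in
  -- [1/3, 1], whence `3 * D` and `1 / δ`.
  set C : ℝ := 3 * C₁ + 3 * C₂ + 1 / δ + 3 * D with hC
  have hCpos : 0 < C := by positivity
  have hδ1 : 0 < 1 / δ := by positivity
  have cross : ∀ x y : ↥(S ∪ T), (x : ℝ) ∈ S → (y : ℝ) ∉ S →
      C⁻¹ * dist x y ≤ dist (σ x) (σ y) ∧ dist (σ x) (σ y) ≤ C * dist x y := by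
    intro x y hx hy
    have h1 := hδ' x hx y (hTn y hy)
    have h2 := hD' x hx y (hTn y hy)
    have h3 := hI (f ⟨x, hx⟩)
    have h4 := hI (g ⟨y, hTn y hy⟩)
    have h5 : 1 / 3 ≤ dist (σ x) (σ y) ∧ dist (σ x) (σ y) ≤ 1 := by
      rw [Subtype.dist_eq, dist_comm, Real.dist_eq, hσS x hx, hσT y hy,
        abs_of_nonneg (by linarith)]
      constructor <;> linarith
    rw [Subtype.dist_eq x y]
    constructor
    · rw [inv_mul_le_iff₀ hCpos]
      calc dist (x : ℝ) y ≤ 3 * D * (1 / 3) := by linarith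
        _ ≤ _ := mul_le_mul (by rw [hC]; linarith) h5.1 (by norm_num) hCpos.le
    · calc dist (σ x) (σ y) ≤ 1 / δ * δ := by rw [one_div_mul_cancel hδ.ne']; exact h5.2
        _ ≤ _ := mul_le_mul (by rw [hC]; linarith) h1 hδ.le hCpos.le
  have bilip : ∀ x y : ↥(S ∪ T),
      C⁻¹ * dist x y ≤ dist (σ x) (σ y) ∧ dist (σ x) (σ y) ≤ C * dist x y := by
    have same : ∀ (d d' E : ℝ), 0 < E → 0 ≤ d → 3 * E ≤ C → E⁻¹ * d ≤ d' → d' ≤ E * d →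
        C⁻¹ * d ≤ d' / 3 ∧ d' / 3 ≤ C * d := by
      intro d d' E hE hd hEC h1 h2
      rw [inv_mul_le_iff₀ hE] at h1
      have h0 : 0 ≤ d' := by
        by_contra h
        have : E * d' < 0 := mul_neg_of_pos_of_neg hE (not_le.1 h)
        linarith
      rw [inv_mul_le_iff₀ hCpos]
      have h3 := mul_le_mul_of_nonneg_right hEC h0
      have h4 := mul_le_mul_of_nonneg_right hEC hd
      constructor <;> linarith
    intro x y
    by_cases hx : (x : ℝ) ∈ S <;> by_cases hy : (y : ℝ) ∈ S
    · have h := hf' ⟨x, hx⟩ ⟨y, hy⟩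
      have e : dist (σ x) (σ y) = dist (f ⟨x, hx⟩) (f ⟨y, hy⟩) / 3 := by
        rw [Subtype.dist_eq, Subtype.dist_eq, Real.dist_eq, Real.dist_eq, hσS x hx, hσS y hy,
          ← sub_div, abs_div, abs_of_pos (by norm_num : (0 : ℝ) < 3)]
      rw [e]
      exact same _ _ C₁ hC₁ dist_nonneg (by rw [hC]; linarith) h.1 h.2
    · exact cross x y hx hy
    · rw [dist_comm x y, dist_comm (σ x)]
      exact cross y x hy hx
    · have h := hg' ⟨x, hTn x hx⟩ ⟨y, hTn y hy⟩
      have e : dist (σ x) (σ y) = dist (g ⟨x, hTn x hx⟩) (g ⟨y, hTn y hy⟩) / 3 := by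
        rw [Subtype.dist_eq, Subtype.dist_eq, Real.dist_eq, Real.dist_eq, hσT x hx, hσT y hy,
          add_sub_add_right_eq_sub, ← sub_div, abs_div, abs_of_pos (by norm_num : (0 : ℝ) < 3)]
      rw [e]
      exact same _ _ C₂ hC₂ dist_nonneg (by rw [hC]; linarith) h.1 h.2
  refine ⟨σ, ⟨fun x y hxy => ?_, fun c => ?_⟩, C, hCpos, bilip⟩
  · have := (bilip x y).1
    rw [hxy, dist_self, inv_mul_le_iff₀ hCpos, mul_zero] at this
    exact dist_le_zero.1 this
  · rcases mem_cantorSet_iff.1 c.2 with h | h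
    · obtain ⟨x, hx⟩ := hf.2 ⟨_, h⟩
      refine ⟨⟨x, Or.inl x.2⟩, Subtype.ext ?_⟩
      rw [hσS _ x.2]
      simp only [Subtype.coe_eta, hx]
      ring
    · obtain ⟨x, hx⟩ := hg.2 ⟨_, h⟩
      have hxS : (x : ℝ) ∉ S := fun hxS => Set.disjoint_left.1 hST hxS x.2
      refine ⟨⟨x, Or.inr x.2⟩, Subtype.ext ?_⟩
      rw [hσT _ hxS]
      simp only [Subtype.coe_eta, hx]
      ring

theorem LipschitzEquivalent.biUnion {V : Finset ℤ} (hV : V.Nonempty) {K : ℤ → Set ℝ}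
    (hK : ∀ v ∈ V, IsCompact (K v) ∧ LipschitzEquivalent (K v) cantorSet)
    (hd : ∀ u v, u ≠ v → Disjoint (K u) (K v)) :
    LipschitzEquivalent ↥(⋃ v ∈ V, K v) cantorSet := by
  induction hV using Finset.Nonempty.cons_induction with
  | singleton a =>
    have := (hK a (mem_singleton_self a)).2
    have e : ⋃ v ∈ ({a} : Finset ℤ), K v = K a := by simp
    rwa [e]
  | cons a V ha hV ih =>
    have e : ⋃ v ∈ Finset.cons a V ha, K v = K a ∪ ⋃ v ∈ V, K v := by
      simp only [Finset.mem_cons, Set.iUnion_iUnion_eq_or_left]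
    rw [e]
    refine LipschitzEquivalent.union (hK a (mem_cons_self a V)).1
      (V.isCompact_biUnion fun v hv => (hK v (mem_cons_of_mem hv)).1) ?_
      (hK a (mem_cons_self a V)).2 (ih fun v hv => hK v (mem_cons_of_mem hv))
    rw [Set.disjoint_iUnion₂_right]
    exact fun v hv => hd a v (ne_of_mem_of_not_mem hv ha).symm

/-! ### Rational translates and the conclusion -/

theorem cantorTranslates_one : cantorTranslates 1 {0} 1 = cantorSet := by
  ext x; simp [cantorTranslates]

theorem cantorTranslates_lipschitzEquivalent_of_not_dvd {q : ℤ} (hq0 : 0 < q)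
    (hq : ¬ (3 : ℤ) ∣ q) {V : Finset ℤ} (hV : V.Nonempty) {μ : ℝ} (hμ : 0 < μ) :
    LipschitzEquivalent (cantorTranslates q V μ) cantorSet := by
  obtain ⟨k₁, h₁⟩ := exists_coded_partition hq0 hq hV hμ
  obtain ⟨k₂, h₂⟩ := exists_coded_partition (q := 1) one_pos (by norm_num)
    (singleton_nonempty 0) one_pos
  -- A common exponent gives the pieces and 𝒞 the same alphabet and ratio.
  obtain ⟨K, hK, hd, hKV⟩ := h₁ (k₁ + k₂ + 1) (by omega)
  obtain ⟨K', hK', -, hKC⟩ := h₂ (k₁ + k₂ + 1) (by omega)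
  have hC := (hK' 0 (mem_singleton_self 0)).2
  have e : K' 0 = cantorSet := by
    rw [← cantorTranslates_one, hKC]; simp
  rw [e] at hC
  rw [hKV]
  exact LipschitzEquivalent.biUnion hV (fun v hv => ⟨(hK v hv).1,
    (hK v hv).2.lipschitzEquivalent (by positivity)
      (inv_lt_one_of_one_lt₀ (one_lt_pow₀ (by norm_num) (by omega))) hC⟩) hd

/-- A factor `3` of the denominator can be absorbed into the scale. -/
theorem cantorTranslates_three_mul {q : ℤ} (hq : q ≠ 0) (V : Finset ℤ) (μ : ℝ) :
    cantorTranslates (3 * q) V μ =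
      cantorTranslates q (V ∪ V.image (fun v => v + 2 * q)) (3 * μ) := by
  have hq' : (q : ℝ) ≠ 0 := by exact_mod_cast hq
  ext x
  simp only [cantorTranslates, Set.mem_ofPred_eq, mem_union, mem_image]
  constructor
  · rintro ⟨v, hv, h⟩
    rcases mem_cantorSet_iff.1 h with h | h
    · refine ⟨v, Or.inl hv, ?_⟩
      convert h using 1; push_cast; field_simp
    · refine ⟨v + 2 * q, Or.inr ⟨v, hv, rfl⟩, ?_⟩
      convert h using 1; push_cast; field_simp; ring
  · rintro ⟨w, hv | ⟨v, hv, rfl⟩, h⟩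
    · refine ⟨w, hv, mem_cantorSet_iff.2 (Or.inl ?_)⟩
      convert h using 1; push_cast; field_simp
    · refine ⟨v, hv, mem_cantorSet_iff.2 (Or.inr ?_)⟩
      convert h using 1; push_cast; field_simp; ring

/-- Every finite union of rational translates of the Cantor set is Lipschitz equivalent to it. -/
theorem cantorTranslates_lipschitzEquivalent {q : ℤ} (hq : 0 < q) {V : Finset ℤ}
    (hV : V.Nonempty) {μ : ℝ} (hμ : 0 < μ) :
    LipschitzEquivalent (cantorTranslates q V μ) cantorSet := by
  induction hn : q.natAbs using Nat.strong_induction_on generalizing q V μ with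
  | _ n ih =>
    by_cases h : (3 : ℤ) ∣ q
    · obtain ⟨p, rfl⟩ := h
      rw [cantorTranslates_three_mul (by omega)]
      exact ih p.natAbs (by omega) (by omega) (hV.mono subset_union_left) (by positivity) rfl
    · exact cantorTranslates_lipschitzEquivalent_of_not_dvd hq h hV hμ

theorem LipschitzEquivalent.refl (X : Type*) [MetricSpace X] : LipschitzEquivalent X X :=
  ⟨id, Function.bijective_id, 1, one_pos, fun x y => by simp⟩

theorem lipschitzEquivalent_image_add (a : ℝ) (S : Set ℝ) :
    LipschitzEquivalent ↥((fun x : ℝ => x + a) '' S) S := by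
  refine ⟨((Equiv.addRight a).image S).symm, Equiv.bijective _, 1, one_pos, ?_⟩
  have h : ∀ x : ↥((fun x : ℝ => x + a) '' S),
      ((((Equiv.addRight a).image S).symm x : S) : ℝ) = x - a := by
    rintro ⟨_, x, hx, rfl⟩
    have : ((Equiv.addRight a).image S).symm ⟨x + a, x, hx, rfl⟩ = ⟨x, hx⟩ := by
      rw [Equiv.symm_apply_eq]; rfl
    exact (congrArg Subtype.val this).trans (add_sub_cancel_right x a).symm
  intro x y
  rw [Subtype.dist_eq, Subtype.dist_eq, h x, h y, dist_sub_right]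
  simp

theorem proposition1p3 (α : ℝ)
    (hα : 1 < α ∨ (0 ≤ α ∧ α ≤ 1 ∧ ∃ q : ℚ, (q : ℝ) = α)) :
    LipschitzEquivalent (cantorUnionTranslate α) cantorSet := by
  rcases hα with hα | ⟨-, -, p, rfl⟩
  · refine LipschitzEquivalent.union isCompact_cantorSet
      (isCompact_cantorSet.image (by fun_prop)) ?_ (LipschitzEquivalent.refl _)
      (lipschitzEquivalent_image_add α cantorSet)
    rw [Set.disjoint_left]
    rintro _ hx ⟨y, hy, rfl⟩
    have h1 := (cantorSet_subset_unitInterval hx).2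
    have h2 := (cantorSet_subset_unitInterval hy).1
    simp only at h1
    linarith
  · have e : cantorUnionTranslate p = cantorTranslates p.den {0, p.num} 1 := by
      ext x
      simp only [cantorUnionTranslate, cantorTranslates, Set.mem_union, Set.mem_image,
        Set.mem_ofPred_eq, mem_insert, mem_singleton, exists_eq_or_imp, exists_eq_left, one_mul,
        Int.cast_zero, zero_div, sub_zero, Int.cast_natCast, ← Rat.cast_def]
      refine or_congr_right ⟨?_, fun h => ⟨_, h, by ring⟩⟩
      rintro ⟨y, hy, rfl⟩
      simpa using hy
    rw [e]
    exact cantorTranslates_lipschitzEquivalent (by exact_mod_cast p.den_pos)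
      (insert_nonempty _ _) one_pos
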